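/- Let $\mathcal M$ be a class of two-armed bandit models, i.e. of pairs $\nu=(\nu_1,\nu_2)$ of probability distributions on $\mathbb R$ with finite expectations $\mu_1,\mu_2$, such that $\mu_1\neq\mu_2$ for every $\nu\in\mathcal M$. Assume that $\mathcal M$ is identifiable: there is a set $\mathcal N$ of probability distributions containing $\nu_1$ and $\nu_2$ for all $\nu\in\mathcal M$, and such that $0<\mathrm{KL}(p,q)<+\infty$ for all $p\neq q$ in $\mathcal N$, where $\mathrm{KL}(p,q)=\int\log\frac{dp}{dq}\,dp$ if $p\ll q$, and $+\infty$ otherwise. At each time $t=1,2,\dots$ an agent chooses an arm $A_t\in\{1,2\}$ as a measurable function of $A_1,Z_1,\dots,A_{t-1},Z_{t-1}$ and then receives an independent draw $Z_t$ from $\nu_{A_t}$. Let $\mathbb P_\nu$, $\mathbb E_\nu$ be the resulting law and expectation, and $\mathcal F_t=\sigma(A_1,Z_1,\dots,A_t,Z_t)$. A strategy consists of such a sampling rule, a stopping time $\tau$ of $(\mathcal F_t)_{t\geq 0}$ with $\mathbb P_\nu(\tau<\infty)=1$ for all $\nu\in\mathcal M$, and an $\mathcal F_\tau$-measurable recommended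 arm $\hat a\in\{1,2\}$; the best arm $a^*$ of $\nu$ is the one with the larger expectation. A strategy is $\delta$-PAC on $\mathcal M$ if $\mathbb P_\nu(\hat a=a^*)\ge 1-\delta$ for all $\nu\in\mathcal M$. A fixed-budget algorithm consists, for each $t\in\mathbb N$, of a strategy with $\tau=t$ almost surely under every $\nu\in\mathcal M$; $p_t(\nu)=\mathbb P_\nu(\hat a\ne a^*)$ denotes the error probability of the $t$-th strategy, and the algorithm is consistent if $p_t(\nu)\to 0$ as $t\to\infty$ for every $\nu\in\mathcal M$. Let $\nu=(\nu_1,\nu_2)\in\mathcal M$ be such that $\mu_1>\mu_2$. (a) In the fixed-budget setting, any consistent algorithm satisfies \[\limsup_{t\to\infty}-\frac1t\log p_t(\nu)\le c^*(\nu),\qquad c^*(\nu):=\inf_{(\nu_1',\nu_2')\in\mathcal M:\ \mu_1'<\mu_2'}\max\{\mathrm{KL}(\nu_1',\nu_1),\mathrm{KL}(\nu_2',\nu_2)\}.\] (b) In the fixed-confidence setting, any algorithm that is $\delta$-PAC on $\mathcal M$, with $0<\delta\le 0.15$, satisfies \[\mathbb E_\nu[\tau]\ge\frac{1}{c_*(\nu)}\log\Big(\frac1{2\delta}\Big),\qquad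 c_*(\nu):=\inf_{(\nu_1',\nu_2')\in\mathcal M:\ \mu_1'<\mu_2'}\max\{\mathrm{KL}(\nu_1,\nu_1'),\mathrm{KL}(\nu_2,\nu_2')\}.\] Here $c^*(\nu)$ and $c_*(\nu)$ take values in $[0,+\infty]$, with $\inf\emptyset=+\infty$, $1/0=+\infty$, $1/(+\infty)=0$, and $-\log 0=+\infty$. -/

import Mathlib

open MeasureTheory ProbabilityTheory Filter
open scoped ENNReal

noncomputable section

namespace TwoArmedBandit

/-- A two-armed bandit model: one probability distribution on `ℝ` for each of the two arms.
The first arm is `0 : Fin 2`, the second arm is `1 : Fin 2`. -/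
abbrev BanditModel := Fin 2 → ProbabilityMeasure ℝ

/-- The expectation of arm `a`. -/
def BanditModel.mean (ν : BanditModel) (a : Fin 2) : ℝ := ∫ x, x ∂(ν a : Measure ℝ)

/-- The arm with the highest expectation (used only for models whose means are distinct). -/
def BanditModel.bestArm (ν : BanditModel) : Fin 2 := if ν.mean 1 < ν.mean 0 then 0 else 1

/-- A class of bandit models: every arm has an expectation, and the two expectations differ. -/
structure IsModelClass (M : Set BanditModel) : Prop where
  integrable : ∀ ν ∈ M, ∀ a, Integrable (fun x : ℝ ↦ x) (ν a : Measure ℝ)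
  mean_ne : ∀ ν ∈ M, ν.mean 0 ≠ ν.mean 1

/-- A class `M` is identifiable if all arms of its models lie in a set `N` of distributions, any
two distinct elements of which have positive and finite Kullback-Leibler divergence. -/
def IsIdentifiable (M : Set BanditModel) : Prop :=
  ∃ N : Set (ProbabilityMeasure ℝ), (∀ ν ∈ M, ∀ a, ν a ∈ N) ∧
    ∀ p ∈ N, ∀ q ∈ N, p ≠ q →
      0 < InformationTheory.klDiv (p : Measure ℝ) (q : Measure ℝ) ∧
        InformationTheory.klDiv (p : Measure ℝ) (q : Measure ℝ) < ∞

/-- Trajectories of the process. `ω n` is the pair `(A_{n+1}, Z_{n+1})` of the `(n+1)`-st arm drawn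
and of the `(n+1)`-st observation. -/
abbrev Trajectory := ℕ → Fin 2 × ℝ

/-- The filtration `F_t = σ(A_1, Z_1, …, A_t, Z_t)`; in particular `F_0` is trivial. -/
def history : Filtration ℕ (inferInstance : MeasurableSpace Trajectory) where
  seq t := MeasurableSpace.comap (fun (ω : Trajectory) (s : Set.Iio t) ↦ ω s) inferInstance
  mono' := by
    intro s t hst
    have hg : Measurable (fun (x : Set.Iio t → Fin 2 × ℝ) (i : Set.Iio s) ↦
        x ⟨i, lt_of_lt_of_le i.2 hst⟩) := by fun_prop
    have h := MeasurableSpace.comap_mono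
      (g := fun (ω : Trajectory) (i : Set.Iio t) ↦ ω i) hg.comap_le
    rw [MeasurableSpace.comap_comp] at h
    exact h
  le' t := by
    have hg : Measurable (fun (ω : Trajectory) (i : Set.Iio t) ↦ ω i) := by fun_prop
    exact hg.comap_le

/-- A sampling rule: the arm drawn at each time is a measurable function of the past draws and
observations. -/
structure SamplingRule where
  /-- The first arm drawn. -/
  first : Fin 2
  /-- `next n h` is the arm drawn after the first `n + 1` draws and observations `h`. -/
  next : (n : ℕ) → (Finset.Iic n → Fin 2 × ℝ) → Fin 2
  measurable_next : ∀ n, Measurable (next n)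

/-- The law of the pair `(A, Z)` when arm `A = a` is drawn: `Z` is distributed as `ν a`. -/
def drawKernel (ν : BanditModel) : Kernel (Fin 2) (Fin 2 × ℝ) :=
  Kernel.ofFunOfCountable fun a ↦ (Measure.dirac a).prod (ν a : Measure ℝ)

instance (ν : BanditModel) : IsMarkovKernel (drawKernel ν) :=
  ⟨fun a ↦ inferInstanceAs
    (IsProbabilityMeasure ((Measure.dirac a).prod (ν a : Measure ℝ)))⟩

/-- The law `P_ν` of `(A_1, Z_1, A_2, Z_2, …)` under the model `ν`: given the past, the arm is the
one chosen by the sampling rule, and the observation is a fresh draw from this arm. -/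
def SamplingRule.law (π : SamplingRule) (ν : BanditModel) : Measure Trajectory :=
  Kernel.trajMeasure (X := fun _ ↦ Fin 2 × ℝ) (drawKernel ν π.first)
    (fun n ↦ (drawKernel ν).comap (π.next n) (π.measurable_next n))

/-- A strategy for the class `M`: a sampling rule, a stopping time `τ` that is almost surely finite
under every model of the class, and an `F_τ`-measurable recommended arm. -/
structure Strategy (M : Set BanditModel) extends SamplingRule where
  τ : Trajectory → WithTop ℕ
  isStoppingTime : IsStoppingTime history τ
  τ_finite : ∀ ν ∈ M, ∀ᵐ ω ∂(toSamplingRule.law ν), τ ω ≠ ⊤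
  recommend : Trajectory → Fin 2
  measurable_recommend : Measurable[isStoppingTime.measurableSpace] recommend

variable {M : Set BanditModel}

/-- The expected number of draws `E_ν[τ]`. -/
def Strategy.expectedDraws (S : Strategy M) (ν : BanditModel) : ℝ≥0∞ :=
  ∫⁻ ω, ENat.toENNReal (S.τ ω) ∂(S.law ν)

/-- The probability, under `ν`, of not recommending the best arm. -/
def Strategy.errorProb (S : Strategy M) (ν : BanditModel) : ℝ≥0∞ :=
  S.law ν {ω | S.recommend ω ≠ ν.bestArm}

/-- `S` is `δ`-PAC on the class: it recommends the best arm with probability at least `1 - δ` under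
every model. -/
def Strategy.IsPAC (S : Strategy M) (δ : ℝ) : Prop :=
  ∀ ν ∈ M, 1 - δ ≤ (S.law ν).real {ω | S.recommend ω = ν.bestArm}

/-- `S` uses a fixed budget of `t` draws: `τ = t` almost surely under every model. -/
def Strategy.HasBudget (S : Strategy M) (t : ℕ) : Prop :=
  ∀ ν ∈ M, ∀ᵐ ω ∂(S.law ν), S.τ ω = t

/-- A fixed-budget algorithm: for every budget `t`, a strategy that makes `t` draws. -/
structure FixedBudgetAlgorithm (M : Set BanditModel) where
  strategy : ℕ → Strategy M
  hasBudget : ∀ t, (strategy t).HasBudget t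

/-- The error probability `p_t(ν)` of a fixed-budget algorithm. -/
def FixedBudgetAlgorithm.errorProb (𝒜 : FixedBudgetAlgorithm M) (t : ℕ) (ν : BanditModel) : ℝ≥0∞ :=
  (𝒜.strategy t).errorProb ν

/-- Consistency: `p_t(ν) → 0` as `t → ∞` for every model of the class. -/
def FixedBudgetAlgorithm.IsConsistent (𝒜 : FixedBudgetAlgorithm M) : Prop :=
  ∀ ν ∈ M, Tendsto (fun t ↦ 𝒜.errorProb t ν) atTop (nhds 0)

/-- `c^*(ν)`: the infimum over the models `ν'` of the class with `μ'_1 < μ'_2` of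
`max (KL(ν'_1, ν_1), KL(ν'_2, ν_2))`. It is `∞` if there is no such model. -/
def cUpper (M : Set BanditModel) (ν : BanditModel) : ℝ≥0∞ :=
  ⨅ ν' ∈ {ν' ∈ M | ν'.mean 0 < ν'.mean 1},
    max (InformationTheory.klDiv (ν' 0 : Measure ℝ) (ν 0 : Measure ℝ))
      (InformationTheory.klDiv (ν' 1 : Measure ℝ) (ν 1 : Measure ℝ))

/-- `c_*(ν)`: the infimum over the models `ν'` of the class with `μ'_1 < μ'_2` of
`max (KL(ν_1, ν'_1), KL(ν_2, ν'_2))`. It is `∞` if there is no such model. -/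
def cLower (M : Set BanditModel) (ν : BanditModel) : ℝ≥0∞ :=
  ⨅ ν' ∈ {ν' ∈ M | ν'.mean 0 < ν'.mean 1},
    max (InformationTheory.klDiv (ν 0 : Measure ℝ) (ν' 0 : Measure ℝ))
      (InformationTheory.klDiv (ν 1 : Measure ℝ) (ν' 1 : Measure ℝ))

end TwoArmedBandit

end

/-!
The proof compares two models `ν` and `ν'` of the class through the likelihood ratio of the draws
made up to the stopping time `τ`. The arms are chosen by the same functions of the past under both
models, so this ratio only involves the observations: with `L = ∑_{j < τ} log (dν_A / dν'_A) (Z)`,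
every event `s` of `F_τ` satisfies `P_ν' (s) = E_ν [1_s exp (-L)]`
(`SamplingRule.setLIntegral_exp_neg_llrSum_stopping`). On the other hand each draw contributes at
most `K = max_a KL (ν_a, ν'_a)` to the expectation of `L`, so that `E_ν [L] ≤ K E_ν [τ]`, as in
Wald's identity (`SamplingRule.integral_llrSum_stopping_le`). Jensen's inequality, applied to
`exp (f - L)` with `f` equal to `u` on `s` and to `v` off `s`, then gives
`exp (u P_ν (s) + v P_ν (sᶜ) - K E_ν [τ]) ≤ exp u * P_ν' (s) + exp v * P_ν' (sᶜ)`
(`SamplingRule.exp_le_of_stopping`). Identifiability provides the mutual absolute continuity and the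
finite divergences that this requires.

Both parts are instances of this inequality, for an alternative model `ν'` the best arm of which is
the second one.

* Fixed budget: the change of measure goes from `ν'` to `ν`. The error event for `ν` is a success
  for `ν'`, so its probability under `ν'` is `1 - p_t (ν')` and tends to `1`. The choice
  `exp u = 1 / p_t (ν)` for this event, and `v = 0`, gives
  `- log p_t (ν) ≤ (K t + log 2) / (1 - p_t (ν'))`.
* Fixed confidence: the change of measure goes from `ν` to `ν'`. The choice
  `exp u = (1 - δ) / δ = exp (-v)` for the event that the first arm is recommended makes the
  right-hand side at most `1`, so `(1 - 2 δ) log ((1 - δ) / δ) ≤ K E_ν [τ]`, and the left-hand side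
  is at least `log (1 / (2 δ))` for `δ ≤ 0.15`.
-/

namespace TwoArmedBandit

/-! ### The law of the trajectories, one step at a time -/

/-- The arm drawn at (zero-based) time `j`, as a function of the trajectory; it depends on the
first `j` coordinates only. -/
def SamplingRule.arm (π : SamplingRule) : ℕ → Trajectory → Fin 2
  | 0, _ => π.first
  | n + 1, ω => π.next n (Preorder.frestrictLe n ω)

lemma SamplingRule.measurable_arm (π : SamplingRule) (j : ℕ) : Measurable (π.arm j) := by
  cases j with
  | zero => exact measurable_const
  | succ n => exact (π.measurable_next n).comp (Preorder.measurable_frestrictLe n)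

instance (π : SamplingRule) (ν : BanditModel) : IsProbabilityMeasure (π.law ν) := by
  unfold SamplingRule.law
  infer_instance

lemma lintegral_drawKernel (ν : BanditModel) (a : Fin 2) {f : Fin 2 × ℝ → ℝ≥0∞}
    (hf : Measurable f) :
    ∫⁻ x, f x ∂(drawKernel ν a) = ∫⁻ z, f (a, z) ∂(ν a : Measure ℝ) := by
  change ∫⁻ x, f x ∂((Measure.dirac a).prod (ν a : Measure ℝ)) = _
  rw [Measure.dirac_prod, lintegral_map hf (by fun_prop)]

lemma SamplingRule.lintegral_law_succ (π : SamplingRule) (ν : BanditModel) (n : ℕ)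
    {G : (Finset.Iic n → Fin 2 × ℝ) × (Fin 2 × ℝ) → ℝ≥0∞} (hG : Measurable G) :
    ∫⁻ ω, G (Preorder.frestrictLe n ω, ω (n + 1)) ∂(π.law ν) =
      ∫⁻ ω, ∫⁻ x, G (Preorder.frestrictLe n ω, x) ∂(drawKernel ν (π.arm (n + 1) ω)) ∂(π.law ν) := by
  have h := Kernel.map_frestrictLe_trajMeasure_compProd_eq_map_trajMeasure
    (X := fun _ ↦ Fin 2 × ℝ) (μ₀ := drawKernel ν π.first)
    (κ := fun n ↦ (drawKernel ν).comap (π.next n) (π.measurable_next n)) (a := n)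
  change (π.law ν).map _ ⊗ₘ _ = (π.law ν).map _ at h
  have hm : Measurable fun ω : Trajectory ↦
      (Preorder.frestrictLe (π := fun _ ↦ Fin 2 × ℝ) n ω, ω (n + 1)) := by
    fun_prop
  rw [← lintegral_map hG hm, ← h, Measure.lintegral_compProd hG,
    lintegral_map (hG.lintegral_kernel_prod_right') (by fun_prop)]
  rfl

lemma SamplingRule.lintegral_law_zero (π : SamplingRule) (ν : BanditModel)
    {g : Fin 2 × ℝ → ℝ≥0∞} (hg : Measurable g) :
    ∫⁻ ω, g (ω 0) ∂(π.law ν) = ∫⁻ x, g x ∂(drawKernel ν π.first) := by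
  have h : (π.law ν).map (Preorder.frestrictLe (π := fun _ ↦ Fin 2 × ℝ) 0) =
      (drawKernel ν π.first).map
        (MeasurableEquiv.piUnique (fun _ : Finset.Iic 0 ↦ Fin 2 × ℝ)).symm := by
    unfold SamplingRule.law Kernel.trajMeasure
    rw [Measure.map_comp _ _ (by fun_prop), Kernel.traj_map_frestrictLe,
      Kernel.partialTraj_self, Measure.id_comp]
  have hG : Measurable fun h : Finset.Iic 0 → Fin 2 × ℝ ↦ g (h ⟨0, by simp⟩) := by fun_prop
  refine (lintegral_map hG
    (Preorder.measurable_frestrictLe (X := fun _ ↦ Fin 2 × ℝ) 0)).symm.trans ?_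
  rw [h, lintegral_map hG (by fun_prop)]
  rfl

/-- An event of the `σ`-algebra `F_{n+1}` is an event on the first `n + 1` coordinates. -/
lemma exists_preimage_frestrictLe {n : ℕ} {s : Set Trajectory}
    (hs : MeasurableSet[history (n + 1)] s) :
    ∃ B : Set (Finset.Iic n → Fin 2 × ℝ), MeasurableSet B ∧ Preorder.frestrictLe n ⁻¹' B = s := by
  obtain ⟨B, hB, rfl⟩ := hs
  refine ⟨(fun h (i : Set.Iio (n + 1)) ↦ h ⟨i, Finset.mem_Iic.2 (Nat.lt_succ_iff.1 i.2)⟩) ⁻¹' B,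
    measurableSet_preimage (by fun_prop) hB, rfl⟩

/-- The `σ`-algebra `F_0` is trivial. -/
lemma eq_empty_or_univ_of_history_zero {s : Set Trajectory}
    (hs : MeasurableSet[history 0] s) : s = ∅ ∨ s = Set.univ := by
  obtain ⟨B, hB, rfl⟩ := hs
  have : Subsingleton (Set.Iio 0 → Fin 2 × ℝ) := ⟨fun f g ↦ funext fun i ↦ absurd i.2 (by simp)⟩
  rcases B.eq_empty_or_nonempty with h | h
  · left; rw [h]; rfl
  · right; rw [h.eq_univ]; rfl

/-- On an event of the past `F_j`, the observation at time `j` is a fresh draw from the arm chosen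
at time `j`. -/
lemma SamplingRule.map_restrict_law (π : SamplingRule) (ν : BanditModel) (j : ℕ)
    {s : Set Trajectory} (hs : MeasurableSet[history j] s) :
    ((π.law ν).restrict s).map (fun ω ↦ ω j) =
      ∑ a, π.law ν (s ∩ {ω | π.arm j ω = a}) • drawKernel ν a := by
  have hs' : MeasurableSet s := history.le j s hs
  ext C hC
  rw [Measure.map_apply (by fun_prop) hC,
    Measure.restrict_apply (measurableSet_preimage (by fun_prop) hC)]
  have harm (a : Fin 2) : MeasurableSet {ω | π.arm j ω = a} :=
    π.measurable_arm j (measurableSet_singleton a)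
  have key : π.law ν ((fun ω : Trajectory ↦ ω j) ⁻¹' C ∩ s) =
      ∫⁻ ω in s, drawKernel ν (π.arm j ω) C ∂(π.law ν) := by
    cases j with
    | zero =>
      rcases eq_empty_or_univ_of_history_zero hs with rfl | rfl
      · simp
      · have := π.lintegral_law_zero ν (measurable_one.indicator hC)
        rw [lintegral_indicator_one hC] at this
        simp only [Set.inter_univ, Measure.restrict_univ, SamplingRule.arm, lintegral_const,
          measure_univ, mul_one]
        rw [← this, ← lintegral_indicator_one (measurableSet_preimage (by fun_prop) hC)]
        rfl
    | succ n =>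
      obtain ⟨B, hB, rfl⟩ := exists_preimage_frestrictLe hs
      have := π.lintegral_law_succ ν n (measurable_one.indicator (hB.prod hC))
      rw [← lintegral_indicator hs', ← lintegral_indicator_one
        ((measurableSet_preimage (by fun_prop) hC).inter hs')]
      refine Eq.trans (lintegral_congr fun ω ↦ ?_) (this.trans (lintegral_congr fun ω ↦ ?_))
      · by_cases h : ω (n + 1) ∈ C ∧ Preorder.frestrictLe n ω ∈ B
        · rw [Set.indicator_of_mem (by exact h), Set.indicator_of_mem (by exact h.symm)]
          rfl
        · rw [Set.indicator_of_notMem (by exact h),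
            Set.indicator_of_notMem (by exact fun h' ↦ h h'.symm)]
      · by_cases h : Preorder.frestrictLe n ω ∈ B
        · rw [Set.indicator_of_mem (by exact h), ← lintegral_indicator_one hC]
          refine lintegral_congr fun x ↦ ?_
          by_cases hx : x ∈ C
          · rw [Set.indicator_of_mem (by exact ⟨h, hx⟩), Set.indicator_of_mem hx]
            rfl
          · rw [Set.indicator_of_notMem (by exact fun h' ↦ hx h'.2), Set.indicator_of_notMem hx]
        · rw [Set.indicator_of_notMem (by exact h)]
          simp [h]
  rw [key]
  have e : ∀ ω, drawKernel ν (π.arm j ω) C =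
      ∑ a, {ω | π.arm j ω = a}.indicator (fun _ ↦ drawKernel ν a C) ω := by
    intro ω
    rw [Finset.sum_eq_single (π.arm j ω)]
    · simp
    · intro b _ hb
      simp [hb.symm]
    · simp
  simp_rw [e]
  rw [lintegral_finsetSum _ fun a _ ↦ measurable_const.indicator (harm a)]
  simp only [Measure.coe_finsetSum, Finset.sum_apply, Measure.smul_apply, smul_eq_mul]
  refine Finset.sum_congr rfl fun a _ ↦ ?_
  rw [lintegral_indicator_const (harm a), Measure.restrict_apply (harm a), Set.inter_comm, mul_comm]

/-! ### Change of measure -/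

/-- The log-likelihood ratio of one draw `x = (A, Z)` between the models `ν` and `ν'`. -/
noncomputable def drawLLR (ν ν' : BanditModel) (x : Fin 2 × ℝ) : ℝ :=
  llr (ν x.1 : Measure ℝ) (ν' x.1 : Measure ℝ) x.2

/-- The log-likelihood ratio of the first `k` draws between the models `ν` and `ν'`. The choices of
the arms do not contribute, being the same functions of the past under both models. -/
noncomputable def llrSum (ν ν' : BanditModel) (k : ℕ) (ω : Trajectory) : ℝ :=
  ∑ j ∈ Finset.range k, drawLLR ν ν' (ω j)

@[fun_prop]
lemma measurable_drawLLR (ν ν' : BanditModel) : Measurable (drawLLR ν ν') :=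
  measurable_from_prod_countable_right fun a ↦
    measurable_llr (ν a : Measure ℝ) (ν' a : Measure ℝ)

/-- `exp (-llr p q)` is the density of `q` with respect to `p`. -/
lemma lintegral_mul_exp_neg_llr {α : Type*} [MeasurableSpace α] {p q : Measure α}
    [SigmaFinite p] [SigmaFinite q] (hpq : p ≪ q) (hqp : q ≪ p) {f : α → ℝ≥0∞}
    (hf : Measurable f) :
    ∫⁻ z, f z * ENNReal.ofReal (Real.exp (-llr p q z)) ∂p = ∫⁻ z, f z ∂q := by
  rw [← lintegral_rnDeriv_mul hqp hf.aemeasurable]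
  refine lintegral_congr_ae ?_
  filter_upwards [exp_neg_llr hpq, q.rnDeriv_lt_top p] with z hz hz'
  rw [hz, ENNReal.ofReal_toReal hz'.ne, mul_comm]

lemma lintegral_drawKernel_mul_exp_neg {ν ν' : BanditModel} {a : Fin 2}
    (h : (ν a : Measure ℝ) ≪ ν' a) (h' : (ν' a : Measure ℝ) ≪ ν a)
    {f : Fin 2 × ℝ → ℝ≥0∞} (hf : Measurable f) :
    ∫⁻ x, f x * ENNReal.ofReal (Real.exp (-drawLLR ν ν' x)) ∂(drawKernel ν a) =
      ∫⁻ x, f x ∂(drawKernel ν' a) := by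
  rw [lintegral_drawKernel _ _ (by fun_prop), lintegral_drawKernel _ _ hf]
  exact lintegral_mul_exp_neg_llr h h' (f := fun z ↦ f (a, z)) (by fun_prop)

/-- The first `n + 2` coordinates of a trajectory, rebuilt from the first `n + 1` coordinates and
from the next one. -/
def appendDraw (n : ℕ) (p : (Finset.Iic n → Fin 2 × ℝ) × (Fin 2 × ℝ)) :
    Finset.Iic (n + 1) → Fin 2 × ℝ :=
  fun i ↦ if h : (i : ℕ) ≤ n then p.1 ⟨i, Finset.mem_Iic.2 h⟩ else p.2

@[fun_prop]
lemma measurable_appendDraw (n : ℕ) : Measurable (appendDraw n) := by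
  refine measurable_pi_iff.2 fun i ↦ ?_
  by_cases h : (i : ℕ) ≤ n
  · simp only [appendDraw, h, dite_true]
    fun_prop
  · simp only [appendDraw, h, dite_false]
    fun_prop

lemma appendDraw_frestrictLe (n : ℕ) (ω : Trajectory) :
    appendDraw n (Preorder.frestrictLe n ω, ω (n + 1)) = Preorder.frestrictLe (n + 1) ω := by
  funext i
  by_cases h : (i : ℕ) ≤ n
  · simp [appendDraw, h]
  · have hi : (i : ℕ) = n + 1 := by
      have := Finset.mem_Iic.1 i.2
      omega
    simp [appendDraw, h, ← hi]

lemma llrSum_succ (ν ν' : BanditModel) (k : ℕ) (ω : Trajectory) :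
    llrSum ν ν' (k + 1) ω = llrSum ν ν' k ω + drawLLR ν ν' (ω k) :=
  Finset.sum_range_succ _ _

lemma llrSum_eq_sum_frestrictLe (ν ν' : BanditModel) (n : ℕ) (ω : Trajectory) :
    llrSum ν ν' (n + 1) ω =
      ∑ i : Finset.Iic n, drawLLR ν ν' (Preorder.frestrictLe n ω i) := by
  rw [llrSum, Nat.range_succ_eq_Iic]
  exact (Finset.sum_coe_sort (Finset.Iic n) fun j ↦ drawLLR ν ν' (ω j)).symm

/-- The law of the first `n + 1` draws under `ν'` has density `exp (-llrSum ν ν' (n + 1))` with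
respect to their law under `ν`. -/
lemma SamplingRule.lintegral_mul_exp_neg_llrSum (π : SamplingRule) {ν ν' : BanditModel}
    (h : ∀ a, (ν a : Measure ℝ) ≪ ν' a) (h' : ∀ a, (ν' a : Measure ℝ) ≪ ν a) (n : ℕ)
    {G : (Finset.Iic n → Fin 2 × ℝ) → ℝ≥0∞} (hG : Measurable G) :
    ∫⁻ ω, G (Preorder.frestrictLe n ω) *
        ENNReal.ofReal (Real.exp (-llrSum ν ν' (n + 1) ω)) ∂(π.law ν) =
      ∫⁻ ω, G (Preorder.frestrictLe n ω) ∂(π.law ν') := by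
  induction n with
  | zero =>
    have hg : Measurable fun x : Fin 2 × ℝ ↦ G fun _ ↦ x := by fun_prop
    have e : ∀ ω : Trajectory, G (Preorder.frestrictLe 0 ω) = G fun _ ↦ ω 0 := by
      intro ω
      congr 1
      funext i
      have : (i : ℕ) = 0 := Nat.le_zero.1 (Finset.mem_Iic.1 i.2)
      simp [this]
    simp only [e, llrSum, zero_add, Finset.sum_range_one]
    rw [π.lintegral_law_zero ν (g := fun x ↦ (G fun _ ↦ x) *
        ENNReal.ofReal (Real.exp (-drawLLR ν ν' x))) (by fun_prop),
      π.lintegral_law_zero ν' hg, lintegral_drawKernel_mul_exp_neg (h _) (h' _) hg]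
  | succ n ih =>
    have hG' : Measurable fun p ↦ G (appendDraw n p) := hG.comp (measurable_appendDraw n)
    -- the conditional expectation under `ν'` of `G`, given the first `n + 1` draws
    let H : (Finset.Iic n → Fin 2 × ℝ) → ℝ≥0∞ := fun p ↦
      ∫⁻ x, G (appendDraw n (p, x)) ∂(drawKernel ν' (π.next n p))
    have hH : Measurable H := by
      have := hG'.lintegral_kernel_prod_right'
        (κ := (drawKernel ν').comap (π.next n) (π.measurable_next n))
      exact this
    let m : (Finset.Iic n → Fin 2 × ℝ) → ℝ≥0∞ := fun p ↦
      ENNReal.ofReal (Real.exp (-∑ i, drawLLR ν ν' (p i)))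
    have hm : Measurable m := by fun_prop
    have hmω (ω : Trajectory) : ENNReal.ofReal (Real.exp (-llrSum ν ν' (n + 1) ω)) =
        m (Preorder.frestrictLe n ω) := by rw [llrSum_eq_sum_frestrictLe]
    let W : (Finset.Iic n → Fin 2 × ℝ) × (Fin 2 × ℝ) → ℝ≥0∞ := fun p ↦
      m p.1 * (G (appendDraw n p) * ENNReal.ofReal (Real.exp (-drawLLR ν ν' p.2)))
    have hW : Measurable W := by fun_prop
    calc ∫⁻ ω, G (Preorder.frestrictLe (n + 1) ω) *
          ENNReal.ofReal (Real.exp (-llrSum ν ν' (n + 1 + 1) ω)) ∂(π.law ν)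
        = ∫⁻ ω, W (Preorder.frestrictLe n ω, ω (n + 1)) ∂(π.law ν) := by
          refine lintegral_congr fun ω ↦ ?_
          simp only [W, appendDraw_frestrictLe, ← hmω]
          rw [llrSum_succ _ _ (n + 1), neg_add, Real.exp_add, ENNReal.ofReal_mul (by positivity)]
          ring
      _ = ∫⁻ ω, H (Preorder.frestrictLe n ω) *
            ENNReal.ofReal (Real.exp (-llrSum ν ν' (n + 1) ω)) ∂(π.law ν) := by
          refine (π.lintegral_law_succ ν n hW).trans (lintegral_congr fun ω ↦ ?_)
          simp only [W]
          rw [lintegral_const_mul _ (by fun_prop),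
            lintegral_drawKernel_mul_exp_neg (h _) (h' _)
              (f := fun x ↦ G (appendDraw n (Preorder.frestrictLe n ω, x))) (by fun_prop),
            hmω, mul_comm]
          rfl
      _ = ∫⁻ ω, H (Preorder.frestrictLe n ω) ∂(π.law ν') := ih hH
      _ = ∫⁻ ω, G (Preorder.frestrictLe (n + 1) ω) ∂(π.law ν') := by
          simp_rw [← appendDraw_frestrictLe]
          rw [π.lintegral_law_succ ν' n hG']
          rfl

/-- Change of measure on the events of `F_k`. -/
lemma SamplingRule.setLIntegral_exp_neg_llrSum (π : SamplingRule) {ν ν' : BanditModel}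
    (h : ∀ a, (ν a : Measure ℝ) ≪ ν' a) (h' : ∀ a, (ν' a : Measure ℝ) ≪ ν a) (k : ℕ)
    {s : Set Trajectory} (hs : MeasurableSet[history k] s) :
    ∫⁻ ω in s, ENNReal.ofReal (Real.exp (-llrSum ν ν' k ω)) ∂(π.law ν) = π.law ν' s := by
  have hs' : MeasurableSet s := history.le k s hs
  cases k with
  | zero =>
    rcases eq_empty_or_univ_of_history_zero hs with rfl | rfl <;> simp [llrSum]
  | succ n =>
    obtain ⟨B, hB, rfl⟩ := exists_preimage_frestrictLe hs
    have := π.lintegral_mul_exp_neg_llrSum h h' n (measurable_one.indicator hB)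
    rw [← lintegral_indicator hs', ← lintegral_indicator_one hs']
    refine Eq.trans (lintegral_congr fun ω ↦ ?_) this
    by_cases hω : Preorder.frestrictLe n ω ∈ B
    · rw [Set.indicator_of_mem (by exact hω), Set.indicator_of_mem hω, Pi.one_apply, one_mul]
    · rw [Set.indicator_of_notMem (by exact hω), Set.indicator_of_notMem hω, zero_mul]

/-- Change of measure at a stopping time: on the events of `F_τ`, the likelihood ratio of the two
laws is the one of the draws made before `τ`. -/
lemma SamplingRule.setLIntegral_exp_neg_llrSum_stopping (π : SamplingRule) {ν ν' : BanditModel}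
    (h : ∀ a, (ν a : Measure ℝ) ≪ ν' a) (h' : ∀ a, (ν' a : Measure ℝ) ≪ ν a)
    {τ : Trajectory → WithTop ℕ} (hτ : IsStoppingTime history τ)
    (hfin : ∀ᵐ ω ∂(π.law ν), τ ω ≠ ⊤) (hfin' : ∀ᵐ ω ∂(π.law ν'), τ ω ≠ ⊤)
    {s : Set Trajectory} (hs : MeasurableSet[hτ.measurableSpace] s) :
    ∫⁻ ω in s, ENNReal.ofReal (Real.exp (-llrSum ν ν' (τ ω).untopA ω)) ∂(π.law ν) =
      π.law ν' s := by
  have hk (k : ℕ) : MeasurableSet[history k] (s ∩ {ω | τ ω = k}) :=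
    (hτ.measurableSet_inter_eq_iff s k).1 (hs.inter (hτ.measurableSet_eq_of_countable' k))
  have hk' (k : ℕ) : MeasurableSet (s ∩ {ω | τ ω = k}) := history.le k _ (hk k)
  have hdisj : Pairwise (Function.onFun Disjoint fun k : ℕ ↦ s ∩ {ω | τ ω = k}) := by
    intro i j hij
    refine Set.disjoint_left.2 fun ω hi hj ↦ hij ?_
    exact WithTop.coe_injective (hi.2.symm.trans hj.2)
  have hunion {μ : Measure Trajectory} (hμ : ∀ᵐ ω ∂μ, τ ω ≠ ⊤) :
      s =ᵐ[μ] ⋃ k : ℕ, s ∩ {ω | τ ω = k} := by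
    filter_upwards [hμ] with ω hω
    obtain ⟨k, hk⟩ := WithTop.ne_top_iff_exists.1 hω
    refine propext ⟨fun h ↦ Set.mem_iUnion.2 ⟨k, h, hk.symm⟩, fun h ↦ ?_⟩
    obtain ⟨j, hj⟩ := Set.mem_iUnion.1 h
    exact hj.1
  rw [setLIntegral_congr (hunion hfin), lintegral_iUnion hk' hdisj, measure_congr (hunion hfin'),
    measure_iUnion hdisj hk']
  refine tsum_congr fun k ↦ ?_
  rw [← π.setLIntegral_exp_neg_llrSum h h' k (hk k)]
  refine setLIntegral_congr_fun (hk' k) fun ω hω ↦ ?_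
  have : τ ω = k := hω.2
  simp only [this]
  rfl

/-! ### The expected log-likelihood ratio at a stopping time -/

lemma drawKernel_eq_map (ν : BanditModel) (a : Fin 2) :
    drawKernel ν a = (ν a : Measure ℝ).map (fun z ↦ (a, z)) := Measure.dirac_prod a

lemma integrable_drawLLR {ν ν' : BanditModel} {a : Fin 2}
    (h : Integrable (llr (ν a : Measure ℝ) (ν' a)) (ν a : Measure ℝ)) :
    Integrable (drawLLR ν ν') (drawKernel ν a) := by
  rw [drawKernel_eq_map, integrable_map_measure (by fun_prop) (by fun_prop)]
  exact h

lemma integral_drawLLR (ν ν' : BanditModel) (a : Fin 2) :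
    ∫ x, drawLLR ν ν' x ∂(drawKernel ν a) =
      ∫ z, llr (ν a : Measure ℝ) (ν' a) z ∂(ν a : Measure ℝ) := by
  rw [drawKernel_eq_map, integral_map (by fun_prop) (by fun_prop)]
  rfl

lemma SamplingRule.sum_law_inter_arm (π : SamplingRule) (ν : BanditModel) (j : ℕ)
    {s : Set Trajectory} (hs : MeasurableSet[history j] s) :
    ∑ a, π.law ν (s ∩ {ω | π.arm j ω = a}) = π.law ν s := by
  have h := congrArg (fun μ ↦ μ Set.univ) (π.map_restrict_law ν j hs)
  simp only [Measure.map_apply (measurable_pi_apply j) MeasurableSet.univ, Set.preimage_univ,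
    Measure.restrict_apply_univ] at h
  simpa using h.symm

lemma SamplingRule.setLIntegral_enorm_drawLLR_le (π : SamplingRule) {ν ν' : BanditModel} (j : ℕ)
    {s : Set Trajectory} (hs : MeasurableSet[history j] s) :
    ∫⁻ ω in s, ‖drawLLR ν ν' (ω j)‖ₑ ∂(π.law ν) ≤
      (∑ a, ∫⁻ x, ‖drawLLR ν ν' x‖ₑ ∂(drawKernel ν a)) * π.law ν s := by
  rw [← lintegral_map (f := fun x ↦ ‖drawLLR ν ν' x‖ₑ) (by fun_prop) (measurable_pi_apply j),
    π.map_restrict_law ν j hs, lintegral_finsetSum_measure, ← π.sum_law_inter_arm ν j hs,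
    Finset.mul_sum]
  refine Finset.sum_le_sum fun a _ ↦ ?_
  rw [lintegral_smul_measure, smul_eq_mul, mul_comm]
  gcongr
  exact Finset.single_le_sum (f := fun a ↦ ∫⁻ x, ‖drawLLR ν ν' x‖ₑ ∂(drawKernel ν a))
    (fun _ _ ↦ zero_le) (Finset.mem_univ a)

lemma SamplingRule.setIntegral_drawLLR_le (π : SamplingRule) {ν ν' : BanditModel} {K : ℝ}
    (hint : ∀ a, Integrable (llr (ν a : Measure ℝ) (ν' a)) (ν a : Measure ℝ))
    (hK : ∀ a, ∫ z, llr (ν a : Measure ℝ) (ν' a) z ∂(ν a : Measure ℝ) ≤ K) (j : ℕ)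
    {s : Set Trajectory} (hs : MeasurableSet[history j] s) :
    ∫ ω in s, drawLLR ν ν' (ω j) ∂(π.law ν) ≤ K * (π.law ν).real s := by
  rw [← integral_map (φ := fun ω : Trajectory ↦ ω j)
    (measurable_pi_apply j).aemeasurable (by fun_prop),
    π.map_restrict_law ν j hs, integral_finsetSum_measure
      fun a _ ↦ (integrable_drawLLR (hint a)).smul_measure (measure_ne_top _ _),
    measureReal_def, ← π.sum_law_inter_arm ν j hs,
    ENNReal.toReal_sum fun a _ ↦ measure_ne_top _ _, Finset.mul_sum]
  refine Finset.sum_le_sum fun a _ ↦ ?_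
  rw [integral_smul_measure, smul_eq_mul, mul_comm, integral_drawLLR]
  exact mul_le_mul_of_nonneg_right (hK a) ENNReal.toReal_nonneg

lemma tsum_measure_lt_stopping {μ : Measure Trajectory} {τ : Trajectory → WithTop ℕ}
    (hτ : IsStoppingTime history τ) (hfin : ∀ᵐ ω ∂μ, τ ω ≠ ⊤) :
    ∑' j : ℕ, μ {ω | j < τ ω} = ∫⁻ ω, ENat.toENNReal (τ ω) ∂μ := by
  have hm (j : ℕ) : MeasurableSet {ω | j < τ ω} := history.le j _ (hτ.measurableSet_gt j)
  have : ∀ᵐ ω ∂μ, ENat.toENNReal (τ ω) = ∑' j : ℕ, {ω | j < τ ω}.indicator 1 ω := by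
    filter_upwards [hfin] with ω hω
    obtain ⟨k, hk⟩ := WithTop.ne_top_iff_exists.1 hω
    rw [tsum_eq_sum (s := Finset.range k), ← hk, Finset.sum_congr rfl (g := fun _ ↦ 1)]
    · simp
      rfl
    · intro j hj
      refine Set.indicator_of_mem ?_ _
      simpa [← hk] using hj
    · intro j hj
      refine Set.indicator_of_notMem ?_ _
      simpa [← hk] using hj
  rw [lintegral_congr_ae this, lintegral_tsum fun j ↦ (measurable_one.indicator (hm j)).aemeasurable]
  exact tsum_congr fun j ↦ (lintegral_indicator_one (hm j)).symm

/-- The log-likelihood ratio of the draws made before a finite time is a series, the terms of which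
are the draws `j` weighted by the events `j < τ` of `F_j`. -/
lemma hasSum_llrSum_untopA (ν ν' : BanditModel) {τ : Trajectory → WithTop ℕ} {ω : Trajectory}
    (hω : τ ω ≠ ⊤) :
    HasSum (fun j : ℕ ↦ {ω | j < τ ω}.indicator (fun ω ↦ drawLLR ν ν' (ω j)) ω)
      (llrSum ν ν' (τ ω).untopA ω) := by
  obtain ⟨k, hk⟩ := WithTop.ne_top_iff_exists.1 hω
  have e : llrSum ν ν' (τ ω).untopA ω = ∑ j ∈ Finset.range k,
      {ω | (j : WithTop ℕ) < τ ω}.indicator (fun ω ↦ drawLLR ν ν' (ω j)) ω := by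
    rw [← hk]
    refine Finset.sum_congr rfl fun j hj ↦ ?_
    have hj' : ω ∈ {ω | (j : WithTop ℕ) < τ ω} := by simpa [← hk] using hj
    rw [Set.indicator_of_mem hj']
  rw [e]
  refine hasSum_sum_of_ne_finset_zero fun j hj ↦ Set.indicator_of_notMem ?_ _
  simpa [← hk] using hj

/-- A form of Wald's identity: at a stopping time with finite expectation, the expectation of the
log-likelihood ratio is at most the largest divergence between arms times the expected number of
draws. -/
lemma SamplingRule.integral_llrSum_stopping_le (π : SamplingRule) {ν ν' : BanditModel} {K : ℝ}
    (hint : ∀ a, Integrable (llr (ν a : Measure ℝ) (ν' a)) (ν a : Measure ℝ))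
    (hK : ∀ a, ∫ z, llr (ν a : Measure ℝ) (ν' a) z ∂(ν a : Measure ℝ) ≤ K)
    {τ : Trajectory → WithTop ℕ} (hτ : IsStoppingTime history τ)
    (hfin : ∀ᵐ ω ∂(π.law ν), τ ω ≠ ⊤)
    (hE : ∫⁻ ω, ENat.toENNReal (τ ω) ∂(π.law ν) ≠ ∞) :
    Integrable (fun ω ↦ llrSum ν ν' (τ ω).untopA ω) (π.law ν) ∧
      ∫ ω, llrSum ν ν' (τ ω).untopA ω ∂(π.law ν) ≤
        K * (∫⁻ ω, ENat.toENNReal (τ ω) ∂(π.law ν)).toReal := by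
  have hs (j : ℕ) : MeasurableSet[history j] {ω | j < τ ω} := hτ.measurableSet_gt j
  have hs' (j : ℕ) : MeasurableSet {ω | j < τ ω} := history.le j _ (hs j)
  let F : ℕ → Trajectory → ℝ := fun j ↦ {ω | j < τ ω}.indicator fun ω ↦ drawLLR ν ν' (ω j)
  have hF (j : ℕ) : Measurable (F j) :=
    Measurable.indicator (by fun_prop) (hs' j)
  let C : ℝ≥0∞ := ∑ a, ∫⁻ x, ‖drawLLR ν ν' x‖ₑ ∂(drawKernel ν a)
  have hC : C ≠ ∞ := ENNReal.sum_ne_top.2 fun a _ ↦ (integrable_drawLLR (hint a)).2.ne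
  rw [← tsum_measure_lt_stopping hτ hfin] at hE ⊢
  have hFnorm (j : ℕ) : ∫⁻ ω, ‖F j ω‖ₑ ∂(π.law ν) ≤ C * π.law ν {ω | j < τ ω} := by
    refine le_trans (le_of_eq ?_) (π.setLIntegral_enorm_drawLLR_le j (hs j))
    rw [← lintegral_indicator (hs' j)]
    exact lintegral_congr fun ω ↦ enorm_indicator_eq_indicator_enorm _ _
  have hsum : ∑' j, ∫⁻ ω, ‖F j ω‖ₑ ∂(π.law ν) ≠ ∞ := by
    refine ne_top_of_le_ne_top ?_ (ENNReal.tsum_le_tsum hFnorm)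
    rw [ENNReal.tsum_mul_left]
    exact ENNReal.mul_ne_top hC hE
  have hL : (fun ω ↦ ∑' j, F j ω) =ᵐ[π.law ν] fun ω ↦ llrSum ν ν' (τ ω).untopA ω := by
    filter_upwards [hfin] with ω hω
    exact (hasSum_llrSum_untopA ν ν' hω).tsum_eq
  have hLm : AEStronglyMeasurable (fun ω ↦ llrSum ν ν' (τ ω).untopA ω) (π.law ν) := by
    refine aestronglyMeasurable_of_tendsto_ae atTop
      (f := fun n ω ↦ ∑ j ∈ Finset.range n, F j ω) (fun n ↦ by fun_prop) ?_
    filter_upwards [hfin] with ω hω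
    exact (hasSum_llrSum_untopA ν ν' hω).tendsto_sum_nat
  have hFint (j : ℕ) : Integrable (F j) (π.law ν) :=
    ⟨(hF j).aestronglyMeasurable,
      (ne_top_of_le_ne_top hsum (ENNReal.le_tsum j)).lt_top⟩
  refine ⟨⟨hLm, ?_⟩, ?_⟩
  · refine lt_of_le_of_lt ?_ hsum.lt_top
    rw [← lintegral_tsum fun j ↦ (hF j).enorm.aemeasurable]
    refine lintegral_mono_ae ?_
    filter_upwards [hL] with ω hω
    rw [← hω]
    exact enorm_tsum_le_tsum_enorm
  · have hsumreal : Summable fun j ↦ ∫ ω, F j ω ∂(π.law ν) := by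
      refine Summable.of_norm_bounded (ENNReal.summable_toReal hsum) fun j ↦ ?_
      rw [← integral_norm_eq_lintegral_enorm (hFint j).1]
      exact norm_integral_le_integral_norm _
    rw [← integral_congr_ae hL, integral_tsum (fun j ↦ (hF j).aestronglyMeasurable) hsum,
      ENNReal.tsum_toReal_eq fun j ↦ measure_ne_top _ _, ← tsum_mul_left]
    refine hsumreal.tsum_le_tsum (fun j ↦ ?_) ((ENNReal.summable_toReal hE).mul_left K)
    rw [integral_indicator (hs' j)]
    exact π.setIntegral_drawLLR_le hint hK j (hs j)

/-! ### The information inequality -/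

/-- The information inequality: an event of `F_τ` can only be as unlikely under `ν'`, compared with
its probability under `ν`, as the expected number of draws allows. It is the
Donsker-Varadhan inequality for the function equal to `u` on the event and to `v` off it. -/
lemma SamplingRule.exp_le_of_stopping (π : SamplingRule) {ν ν' : BanditModel} {K : ℝ}
    (h : ∀ a, (ν a : Measure ℝ) ≪ ν' a) (h' : ∀ a, (ν' a : Measure ℝ) ≪ ν a)
    (hint : ∀ a, Integrable (llr (ν a : Measure ℝ) (ν' a)) (ν a : Measure ℝ))
    (hK : ∀ a, ∫ z, llr (ν a : Measure ℝ) (ν' a) z ∂(ν a : Measure ℝ) ≤ K)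
    {τ : Trajectory → WithTop ℕ} (hτ : IsStoppingTime history τ)
    (hfin : ∀ᵐ ω ∂(π.law ν), τ ω ≠ ⊤) (hfin' : ∀ᵐ ω ∂(π.law ν'), τ ω ≠ ⊤)
    (hE : ∫⁻ ω, ENat.toENNReal (τ ω) ∂(π.law ν) ≠ ∞)
    {s : Set Trajectory} (hs : MeasurableSet[hτ.measurableSpace] s) (u v : ℝ) :
    Real.exp (u * (π.law ν).real s + v * (1 - (π.law ν).real s) -
        K * (∫⁻ ω, ENat.toENNReal (τ ω) ∂(π.law ν)).toReal) ≤
      Real.exp u * (π.law ν').real s + Real.exp v * (1 - (π.law ν').real s) := by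
  have hs' : MeasurableSet s := hτ.measurableSpace_le s hs
  obtain ⟨hLint, hLle⟩ := π.integral_llrSum_stopping_le hint hK hτ hfin hE
  set L : Trajectory → ℝ := fun ω ↦ llrSum ν ν' (τ ω).untopA ω
  let f : Trajectory → ℝ := fun ω ↦ s.indicator (fun _ ↦ u) ω + sᶜ.indicator (fun _ ↦ v) ω
  have hf1 : Integrable (s.indicator fun _ ↦ u) (π.law ν) := (integrable_const u).indicator hs'
  have hf2 : Integrable (sᶜ.indicator fun _ ↦ v) (π.law ν) :=
    (integrable_const v).indicator hs'.compl
  have hf : Integrable f (π.law ν) := hf1.add hf2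
  have hfint : ∫ ω, f ω ∂(π.law ν) = u * (π.law ν).real s + v * (1 - (π.law ν).real s) := by
    rw [integral_add hf1 hf2, integral_indicator_const _ hs', integral_indicator_const _ hs'.compl,
      probReal_compl_eq_one_sub hs', smul_eq_mul, smul_eq_mul]
    ring
  have hset {t : Set Trajectory} (ht : MeasurableSet[hτ.measurableSpace] t) (w : ℝ)
      (hw : ∀ ω ∈ t, f ω = w) :
      ∫⁻ ω in t, ENNReal.ofReal (Real.exp (f ω - L ω)) ∂(π.law ν) =
        ENNReal.ofReal (Real.exp w) * π.law ν' t := by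
    have ht' : MeasurableSet t := hτ.measurableSpace_le t ht
    rw [← π.setLIntegral_exp_neg_llrSum_stopping h h' hτ hfin hfin' ht,
      ← lintegral_const_mul' _ _ ENNReal.ofReal_ne_top]
    refine setLIntegral_congr_fun ht' fun ω hω ↦ ?_
    simp only [hw ω hω, sub_eq_add_neg, Real.exp_add]
    rw [ENNReal.ofReal_mul (by positivity)]
  have htot : ∫⁻ ω, ENNReal.ofReal (Real.exp (f ω - L ω)) ∂(π.law ν) =
      ENNReal.ofReal (Real.exp u) * π.law ν' s + ENNReal.ofReal (Real.exp v) * π.law ν' sᶜ := by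
    rw [← lintegral_add_compl _ hs', hset hs u fun ω hω ↦ ?_, hset hs.compl v fun ω hω ↦ ?_]
    · have : ω ∉ s := hω
      simp [f, this]
    · simp [f, hω]
  have htop : ∫⁻ ω, ENNReal.ofReal (Real.exp (f ω - L ω)) ∂(π.law ν) ≠ ∞ := by
    rw [htot]
    finiteness
  have hY : Integrable (fun ω ↦ f ω - L ω) (π.law ν) := hf.sub hLint
  have hYm : AEStronglyMeasurable (fun ω ↦ Real.exp (f ω - L ω)) (π.law ν) :=
    Real.continuous_exp.comp_aestronglyMeasurable hY.1
  have hexp : Integrable (fun ω ↦ Real.exp (f ω - L ω)) (π.law ν) :=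
    (lintegral_ofReal_ne_top_iff_integrable hYm (ae_of_all _ fun _ ↦ (Real.exp_pos _).le)).1 htop
  have hval : ∫ ω, Real.exp (f ω - L ω) ∂(π.law ν) =
      Real.exp u * (π.law ν').real s + Real.exp v * (1 - (π.law ν').real s) := by
    rw [integral_eq_lintegral_of_nonneg_ae (ae_of_all _ fun _ ↦ (Real.exp_pos _).le) hYm, htot,
      ENNReal.toReal_add (by finiteness) (by finiteness), ENNReal.toReal_mul, ENNReal.toReal_mul,
      ENNReal.toReal_ofReal (by positivity), ENNReal.toReal_ofReal (by positivity),
      ← probReal_compl_eq_one_sub hs']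
    rfl
  have hjensen := convexOn_exp.map_integral_le (μ := π.law ν) Real.continuous_exp.continuousOn
    isClosed_univ (ae_of_all _ fun _ ↦ Set.mem_univ _) hY hexp
  rw [hval, integral_sub hf hLint, hfint] at hjensen
  refine le_trans (Real.exp_le_exp.2 ?_) hjensen
  linarith

/-! ### Identifiable classes -/

/-- In an identifiable class, any two models are mutually absolutely continuous and have finite
divergences, so that `SamplingRule.exp_le_of_stopping` applies to them. -/
lemma IsIdentifiable.klDiv_ne_top {M : Set BanditModel} (hid : IsIdentifiable M)
    {ν ν' : BanditModel} (hν : ν ∈ M) (hν' : ν' ∈ M) (a : Fin 2) :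
    InformationTheory.klDiv (ν a : Measure ℝ) (ν' a) ≠ ∞ := by
  obtain ⟨N, hN, hkl⟩ := hid
  by_cases h : ν a = ν' a
  · rw [h, InformationTheory.klDiv_self]
    exact ENNReal.zero_ne_top
  · exact (hkl _ (hN ν hν a) _ (hN ν' hν' a) h).2.ne

/-- The information inequality for a strategy, with the divergence between two models of an
identifiable class. -/
lemma Strategy.exp_le_of_mem {M : Set BanditModel} (hid : IsIdentifiable M) (S : Strategy M)
    {ν ν' : BanditModel} (hν : ν ∈ M) (hν' : ν' ∈ M) (hE : S.expectedDraws ν ≠ ∞) (b : Fin 2)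
    (u v : ℝ) :
    Real.exp (u * (S.law ν).real {ω | S.recommend ω = b} +
        v * (1 - (S.law ν).real {ω | S.recommend ω = b}) -
        (max (InformationTheory.klDiv (ν 0 : Measure ℝ) (ν' 0))
          (InformationTheory.klDiv (ν 1 : Measure ℝ) (ν' 1))).toReal *
          (S.expectedDraws ν).toReal) ≤
      Real.exp u * (S.law ν').real {ω | S.recommend ω = b} +
        Real.exp v * (1 - (S.law ν').real {ω | S.recommend ω = b}) := by
  have hkl (a : Fin 2) := InformationTheory.klDiv_ne_top_iff.1 (hid.klDiv_ne_top hν hν' a)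
  have hmax : max (InformationTheory.klDiv (ν 0 : Measure ℝ) (ν' 0))
      (InformationTheory.klDiv (ν 1 : Measure ℝ) (ν' 1)) ≠ ∞ :=
    (max_lt (hid.klDiv_ne_top hν hν' 0).lt_top (hid.klDiv_ne_top hν hν' 1).lt_top).ne
  refine S.exp_le_of_stopping (fun a ↦ (hkl a).1)
    (fun a ↦ (InformationTheory.klDiv_ne_top_iff.1 (hid.klDiv_ne_top hν' hν a)).1)
    (fun a ↦ (hkl a).2) (fun a ↦ ?_) S.isStoppingTime (S.τ_finite ν hν) (S.τ_finite ν' hν') hE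
    (S.measurable_recommend (measurableSet_singleton b)) u v
  rw [← InformationTheory.toReal_klDiv_of_measure_eq (hkl a).1 (by simp)]
  refine ENNReal.toReal_mono hmax ?_
  fin_cases a
  · exact le_max_left _ _
  · exact le_max_right _ _

lemma Strategy.measurableSet_recommend {M : Set BanditModel} (S : Strategy M) (b : Fin 2) :
    MeasurableSet {ω | S.recommend ω = b} :=
  S.isStoppingTime.measurableSpace_le _ (S.measurable_recommend (measurableSet_singleton b))

lemma Strategy.errorProb_toReal {M : Set BanditModel} (S : Strategy M) (ν : BanditModel) :
    (S.errorProb ν).toReal = 1 - (S.law ν).real {ω | S.recommend ω = ν.bestArm} :=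
  probReal_compl_eq_one_sub (S.measurableSet_recommend _)

/-! ### Fixed budget -/

/-- The bound for a single budget `t`, in terms of the error probabilities under `ν` and under an
alternative `ν'` with another best arm. -/
lemma Strategy.neg_log_errorProb_le {M : Set BanditModel} (hid : IsIdentifiable M)
    (S : Strategy M) {t : ℕ} (hS : S.HasBudget t) {ν ν' : BanditModel} (hν : ν ∈ M) (hν' : ν' ∈ M)
    (hbest : ν'.bestArm ≠ ν.bestArm) (hlt : (S.errorProb ν').toReal < 1) :
    S.errorProb ν ≠ 0 ∧ -Real.log (S.errorProb ν).toReal ≤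
      ((max (InformationTheory.klDiv (ν' 0 : Measure ℝ) (ν 0))
          (InformationTheory.klDiv (ν' 1 : Measure ℝ) (ν 1))).toReal * t + Real.log 2) /
        (1 - (S.errorProb ν').toReal) := by
  have hexp : S.expectedDraws ν' = t := by
    unfold Strategy.expectedDraws
    rw [lintegral_congr_ae (g := fun _ ↦ (t : ℝ≥0∞)) ?_]
    · simp
    · filter_upwards [hS ν' hν'] with ω hω
      rw [hω]
      exact ENat.toENNReal_coe t
  have key := fun u ↦ S.exp_le_of_mem hid hν' hν (by rw [hexp]; finiteness) ν.bestArm 0 u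
  have hcompl : {ω | S.recommend ω = ν'.bestArm} = {ω | S.recommend ω = ν.bestArm}ᶜ := by
    ext ω
    simp only [Set.mem_ofPred_eq, Set.mem_compl_iff]
    omega
  have hx : 1 - (S.law ν').real {ω | S.recommend ω = ν.bestArm} =
      1 - (S.errorProb ν').toReal := by
    rw [S.errorProb_toReal, hcompl, probReal_compl_eq_one_sub (S.measurableSet_recommend _)]
    ring
  have hp := S.errorProb_toReal ν
  rw [hx, hexp] at key
  simp only [← hp, ENNReal.toReal_natCast, zero_mul, zero_add, Real.exp_zero, one_mul] at key
  set K := (max (InformationTheory.klDiv (ν' 0 : Measure ℝ) (ν 0))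
          (InformationTheory.klDiv (ν' 1 : Measure ℝ) (ν 1))).toReal
  have hge : 0 ≤ (S.law ν).real {ω | S.recommend ω = ν.bestArm} := measureReal_nonneg
  have hle : (S.law ν).real {ω | S.recommend ω = ν.bestArm} ≤ 1 := measureReal_le_one
  have hx0 : 0 < 1 - (S.errorProb ν').toReal := by linarith
  have hne : S.errorProb ν ≠ 0 := by
    intro h0
    have := key ((K * t + 1) / (1 - (S.errorProb ν').toReal))
    rw [h0, div_mul_cancel₀ _ hx0.ne'] at this
    simp only [ENNReal.toReal_zero, mul_zero, add_zero, add_sub_cancel_left] at this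
    have := Real.exp_one_gt_d9
    linarith
  have hpos : 0 < (S.errorProb ν).toReal := ENNReal.toReal_pos hne (measure_ne_top _ _)
  refine ⟨hne, ?_⟩
  have := key (-Real.log (S.errorProb ν).toReal)
  rw [Real.exp_neg, Real.exp_log hpos, inv_mul_cancel₀ hpos.ne',
    ← Real.le_log_iff_exp_le (by linarith)] at this
  rw [le_div_iff₀ hx0]
  have h2 : Real.log ((S.law ν).real {ω | S.recommend ω = ν.bestArm} + 1) ≤ Real.log 2 :=
    Real.log_le_log (by linarith) (by linarith)
  linarith

lemma BanditModel.bestArm_of_lt {ν : BanditModel} (h : ν.mean 1 < ν.mean 0) : ν.bestArm = 0 :=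
  if_pos h

lemma BanditModel.bestArm_of_gt {ν : BanditModel} (h : ν.mean 0 < ν.mean 1) : ν.bestArm = 1 :=
  if_neg h.not_gt

lemma FixedBudgetAlgorithm.limsup_le_cUpper {M : Set BanditModel} (hid : IsIdentifiable M)
    {ν : BanditModel} (hν : ν ∈ M) (hμ : ν.mean 1 < ν.mean 0) (𝒜 : FixedBudgetAlgorithm M)
    (h𝒜 : 𝒜.IsConsistent) :
    limsup (fun t : ℕ ↦ -(ENNReal.log (𝒜.errorProb t ν) / ((t : ℝ) : EReal))) atTop
      ≤ (cUpper M ν : EReal) := by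
  have hinf : ∀ ν' ∈ {ν' ∈ M | ν'.mean 0 < ν'.mean 1},
      limsup (fun t : ℕ ↦ -(ENNReal.log (𝒜.errorProb t ν) / ((t : ℝ) : EReal))) atTop ≤
        ((max (InformationTheory.klDiv (ν' 0 : Measure ℝ) (ν 0))
          (InformationTheory.klDiv (ν' 1 : Measure ℝ) (ν 1)) : ℝ≥0∞) : EReal) := by
    rintro ν' ⟨hν', hμ'⟩
    have hmax : max (InformationTheory.klDiv (ν' 0 : Measure ℝ) (ν 0))
        (InformationTheory.klDiv (ν' 1 : Measure ℝ) (ν 1)) ≠ ∞ :=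
      (max_lt (hid.klDiv_ne_top hν' hν 0).lt_top (hid.klDiv_ne_top hν' hν 1).lt_top).ne
    have hbest : ν'.bestArm ≠ ν.bestArm := by
      rw [BanditModel.bestArm_of_lt hμ, BanditModel.bestArm_of_gt hμ']
      exact one_ne_zero
    rw [← EReal.coe_toReal (x := ((max _ _ : ℝ≥0∞) : EReal)) (by simpa using hmax) (by simp),
      EReal.toReal_coe_ennreal]
    set K := (max (InformationTheory.klDiv (ν' 0 : Measure ℝ) (ν 0))
          (InformationTheory.klDiv (ν' 1 : Measure ℝ) (ν 1))).toReal
    have herr : Tendsto (fun t ↦ (𝒜.errorProb t ν').toReal) atTop (nhds 0) := by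
      exact (ENNReal.tendsto_toReal ENNReal.zero_ne_top).comp (h𝒜 ν' hν')
    have hlim : Tendsto (fun t : ℕ ↦ (K + Real.log 2 / t) / (1 - (𝒜.errorProb t ν').toReal))
        atTop (nhds K) := by
      have h1 : Tendsto (fun t : ℕ ↦ K + Real.log 2 / t) atTop (nhds (K + 0)) :=
        tendsto_const_nhds.add (tendsto_const_div_atTop_nhds_zero_nat _)
      have h2 := h1.div (tendsto_const_nhds.sub herr) (by norm_num : (1 : ℝ) - 0 ≠ 0)
      rwa [add_zero, sub_zero, div_one] at h2
    rw [← ((continuous_coe_real_ereal.tendsto K).comp hlim).limsup_eq]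
    refine limsup_le_limsup ?_
    filter_upwards [herr.eventually (gt_mem_nhds one_pos), eventually_gt_atTop 0] with t ht ht0
    obtain ⟨hne, hle⟩ := (𝒜.strategy t).neg_log_errorProb_le hid (𝒜.hasBudget t) hν hν' hbest ht
    have ht0' : (0 : ℝ) < t := Nat.cast_pos.2 ht0
    change -(ENNReal.log ((𝒜.strategy t).errorProb ν) / ((t : ℝ) : EReal)) ≤ _
    rw [ENNReal.log_pos_real hne (measure_ne_top _ _), ← EReal.coe_div, ← EReal.coe_neg]
    refine EReal.coe_le_coe_iff.2 ?_
    rw [← neg_div, div_le_iff₀ ht0']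
    refine hle.trans (le_of_eq ?_)
    change (K * t + Real.log 2) / _ =
      (K + Real.log 2 / t) / (1 - ((𝒜.strategy t).errorProb ν').toReal) * t
    field_simp
  refine ((le_max_right 0 _).trans_eq EReal.coe_toENNReal_eq_max.symm).trans
    (EReal.coe_ennreal_le_coe_ennreal_iff.2 ?_)
  refine le_iInf₂ fun ν' hν' ↦ ?_
  simpa using EReal.toENNReal_le_toENNReal (hinf ν' hν')

/-! ### Fixed confidence -/

/-- The comparison of the binary relative entropy of `1 - δ` and `δ` with `log (1 / (2 * δ))`. The
two sides are close to each other at `δ = 0.15`, hence the tangents at this point. -/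
lemma log_one_div_two_mul_le {δ : ℝ} (h0 : 0 < δ) (h1 : δ ≤ 0.15) :
    Real.log (1 / (2 * δ)) ≤ (1 - 2 * δ) * Real.log ((1 - δ) / δ) := by
  have hd : (0 : ℝ) < 1 - δ := by linarith
  have tangent {c x : ℝ} (hc : 0 < c) (hx : 0 < x) : Real.log c + 1 - c / x ≤ Real.log x := by
    have := Real.log_le_sub_one_of_pos (div_pos hc hx)
    rw [Real.log_div hc.ne' hx.ne'] at this
    linarith
  have t1 := tangent (c := 0.15) (by norm_num) h0
  have t2 := tangent (c := 0.85) (by norm_num) hd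
  have t3 : 2 * δ * Real.log 0.15 + 2 * δ - 0.3 ≤ 2 * δ * Real.log δ := by
    have := mul_le_mul_of_nonneg_left t1 (by linarith : 0 ≤ 2 * δ)
    have e : 2 * δ * (Real.log 0.15 + 1 - 0.15 / δ) = 2 * δ * Real.log 0.15 + 2 * δ - 0.3 := by
      field_simp
      ring
    linarith
  have t4 : (1 - 2 * δ) * (Real.log 0.85 + 1) - 0.7 + 20 / 17 * (δ - 0.15) ≤
      (1 - 2 * δ) * Real.log (1 - δ) := by
    have := mul_le_mul_of_nonneg_left t2 (by linarith : 0 ≤ 1 - 2 * δ)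
    -- the left-hand side is concave in `δ`, and `-20 / 17` is its slope at `0.15`
    have e : (1 - 2 * δ) * (0.85 / (1 - δ)) ≤ 0.7 - 20 / 17 * (δ - 0.15) := by
      rw [mul_div_assoc', div_le_iff₀ hd]
      nlinarith [sq_nonneg (δ - 0.15)]
    linarith
  -- after the tangent bounds, the claim is affine in `δ`: `n1` settles the endpoint `0.15`, and
  -- `n2`, `n3` settle the endpoint `0`
  have n1 : 0 ≤ 0.7 * Real.log 0.85 + 0.3 * Real.log 0.15 + Real.log 2 := by
    have := Real.log_nonneg (by norm_num : (1 : ℝ) ≤ 0.85 ^ 7 * 0.15 ^ 3 * 2 ^ 10)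
    rw [Real.log_mul (by norm_num) (by norm_num), Real.log_mul (by norm_num) (by norm_num),
      Real.log_pow, Real.log_pow, Real.log_pow] at this
    push_cast at this
    linarith
  have n2 := tangent (c := 1) (x := 0.85) one_pos (by norm_num)
  have n3 := Real.log_two_gt_d9
  rw [Real.log_one] at n2
  norm_num at n2
  rw [one_div, Real.log_inv, Real.log_mul two_ne_zero h0.ne', Real.log_div hd.ne' h0.ne']
  nlinarith [mul_le_mul_of_nonneg_left n1 h0.le]

lemma Strategy.div_cLower_le_expectedDraws {M : Set BanditModel} (hid : IsIdentifiable M)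
    {ν : BanditModel} (hν : ν ∈ M) (hμ : ν.mean 1 < ν.mean 0) {δ : ℝ} (h0 : 0 < δ)
    (h1 : δ ≤ 0.15) (S : Strategy M) (hS : S.IsPAC δ) :
    ENNReal.ofReal (Real.log (1 / (2 * δ))) / cLower M ν ≤ S.expectedDraws ν := by
  by_cases hE : S.expectedDraws ν = ∞
  · simp [hE]
  have hlog : 0 < Real.log (1 / (2 * δ)) := by
    refine Real.log_pos ?_
    rw [lt_div_iff₀ (by linarith)]
    linarith
  by_cases hc : cLower M ν = ∞
  · simp [hc]
  refine ENNReal.div_le_of_le_mul' ?_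
  rw [← ENNReal.div_le_iff_le_mul (Or.inr hc) (Or.inl hE)]
  refine le_iInf₂ fun ν' ⟨hν', hμ'⟩ ↦ ?_
  have hmax : max (InformationTheory.klDiv (ν 0 : Measure ℝ) (ν' 0))
      (InformationTheory.klDiv (ν 1 : Measure ℝ) (ν' 1)) ≠ ∞ :=
    (max_lt (hid.klDiv_ne_top hν hν' 0).lt_top (hid.klDiv_ne_top hν hν' 1).lt_top).ne
  rw [ENNReal.div_le_iff_le_mul (Or.inr hmax) (Or.inl hE), ← ENNReal.ofReal_toReal hmax,
    ← ENNReal.ofReal_toReal hE, ← ENNReal.ofReal_mul ENNReal.toReal_nonneg]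
  refine ENNReal.ofReal_le_ofReal ((log_one_div_two_mul_le h0 h1).trans ?_)
  have hd : (0 : ℝ) < 1 - δ := by linarith
  have hP := hS ν hν
  have hQ := hS ν' hν'
  have hcompl : {ω | S.recommend ω = 1} = {ω | S.recommend ω = 0}ᶜ := by
    ext ω
    simp only [Set.mem_ofPred_eq, Set.mem_compl_iff]
    omega
  rw [BanditModel.bestArm_of_lt hμ] at hP
  rw [BanditModel.bestArm_of_gt hμ', hcompl,
    probReal_compl_eq_one_sub (S.measurableSet_recommend _)] at hQ
  have key := S.exp_le_of_mem hid hν hν' hE 0 (Real.log ((1 - δ) / δ)) (-Real.log ((1 - δ) / δ))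
  rw [Real.exp_neg, Real.exp_log (by positivity)] at key
  set K := (max (InformationTheory.klDiv (ν 0 : Measure ℝ) (ν' 0))
      (InformationTheory.klDiv (ν 1 : Measure ℝ) (ν' 1))).toReal
  set p := (S.law ν).real {ω | S.recommend ω = 0}
  set q := (S.law ν').real {ω | S.recommend ω = 0}
  -- the right-hand side is increasing in `q` and equals `1` at `q = δ`
  have hle : (1 - δ) / δ * q + ((1 - δ) / δ)⁻¹ * (1 - q) ≤ 1 := by
    have hi : ((1 - δ) / δ)⁻¹ ≤ (1 - δ) / δ := by
      rw [inv_div, div_le_div_iff₀ hd h0]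
      nlinarith
    have e : (1 - δ) / δ * δ + ((1 - δ) / δ)⁻¹ * (1 - δ) = 1 := by
      field_simp
      ring
    nlinarith [mul_nonneg (sub_nonneg.2 hi) (by linarith : 0 ≤ δ - q)]
  have hexp := Real.exp_le_one_iff.1 (key.trans hle)
  have hl : 0 ≤ Real.log ((1 - δ) / δ) := by
    refine Real.log_nonneg ?_
    rw [le_div_iff₀ h0]
    linarith
  nlinarith [mul_nonneg hl (by linarith : 0 ≤ p - (1 - δ))]

end TwoArmedBandit

theorem theorem1 (M : Set TwoArmedBandit.BanditModel)
    (hM : TwoArmedBandit.IsModelClass M) (hid : TwoArmedBandit.IsIdentifiable M)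
    (ν : TwoArmedBandit.BanditModel) (hν : ν ∈ M) (hμ : ν.mean 1 < ν.mean 0) :
    (∀ 𝒜 : TwoArmedBandit.FixedBudgetAlgorithm M, 𝒜.IsConsistent →
      limsup (fun t : ℕ ↦ -(ENNReal.log (𝒜.errorProb t ν) / ((t : ℝ) : EReal))) atTop
        ≤ (TwoArmedBandit.cUpper M ν : EReal)) ∧
    (∀ δ : ℝ, 0 < δ → δ ≤ 0.15 → ∀ S : TwoArmedBandit.Strategy M, S.IsPAC δ →
      ENNReal.ofReal (Real.log (1 / (2 * δ))) / TwoArmedBandit.cLower M ν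
        ≤ S.expectedDraws ν) :=
  ⟨fun 𝒜 h𝒜 ↦ 𝒜.limsup_le_cUpper hid hν hμ h𝒜,
    fun _ h0 h1 S hS ↦ S.div_cLower_le_expectedDraws hid hν hμ h0 h1 hS⟩
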